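/- \textbf{Theorem.} Let $X$ be a set, let $\mathcal H$ be a complex Hilbert space, and let $\mathcal L$ be a reproducing kernel Hilbert space of $\mathcal H$-valued functions on $X$, i.e. a vector space of functions $X\to\mathcal H$ that is a Hilbert space and for which every evaluation $E_x:\mathcal L\to\mathcal H$ is bounded; let $K(x,y)=E_xE_y^*$ be its reproducing kernel. A function $f:X\to\mathbb C$ is a multiplier if $fg\in\mathcal L$ for every $g\in\mathcal L$; then $M_f(g)=fg$ is a bounded operator on $\mathcal L$. Let $\mathcal M(K)$ be the algebra of all multipliers, with the matrix norms inherited from $B(\mathcal L)$: $\|(f_{ij})\|_{M_n(\mathcal M(K))}$ is the norm of $(M_{f_{ij}})$ as an operator on $\mathcal L^{(n)}$, the Hilbert space direct sum of $n$ copies of $\mathcal L$. Suppose that $K(x,x)\neq 0$ for every $x\in X$ and that $\mathcal M(K)$ separates the points of $X$. Then, writing $\mathcal A=\mathcal M(K)$: (1) $\mathcal A$ is an operator algebra of functions on $X$: it is an algebra of functions on $X$ that separates points and contains the constants; its matrix norms satisfy the Blecher--Ruan--Sinclair axioms (each $M_n(\mathcal A)$ is normed; $\|\alpha f\beta\|\le\|\alpha\|\,\|f\|\,\|\beta\|$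 for scalar matrices $\alpha,\beta$; $\|f\oplus g\|=\max(\|f\|,\|g\|)$; $\|fg\|\le\|f\|\,\|g\|$ for $f,g\in M_n(\mathcal A)$; $\|1\|=1$ unless $\mathcal A=0$); and for every $x\in X$ the functional $f\mapsto f(x)$ is bounded on $\mathcal A$. (2) $\mathcal A$ is BPW complete: if a net in $\mathcal A$, bounded in the norm of $\mathcal A$, converges pointwise on $X$ to a function $f$, then $f\in\mathcal A$. (3) $\mathcal A$ is local: for every $n$ and every $(f_{ij})\in M_n(\mathcal A)$, $$\|(f_{ij})\|=\sup_F\ \inf\{\|(f_{ij}+g_{ij})\| : g_{ij}\in\mathcal A,\ g_{ij}|_F=0\},$$ where $F$ runs over the finite subsets of $X$. (4) $\mathcal A$ is a dual operator algebra: there is a complete operator space $V$ such that $\mathcal A$ is completely isometrically isomorphic, as an operator space, to the operator space dual $V^*$, where $M_n(V^*)$ has the norm $\|(\varphi_{ij})\|=\sup\{\|(\varphi_{ij}(v_{kl}))\| : m\in\mathbb N,\ (v_{kl})\in M_m(V),\ \|(v_{kl})\|\le 1\}$. Moreover $\{M_f : f\in\mathcal M(K)\}$ is weak*-closed in $B(\mathcal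 L)$. -/

import Mathlib

universe u v w

open Filter Topology

noncomputable section

namespace FunctionAlgebra

open scoped Matrix.Norms.L2Operator

/-! ### Abstract operator spaces and operator algebras -/

/-- A family of real-valued functions, one on each matrix space `M_n(V)`. -/
abbrev MatrixNorms (V : Type u) : Type u := ∀ n : ℕ, Matrix (Fin n) (Fin n) V → ℝ

/-- The `1 × 1` matrix with entry `a`. -/
def single {V : Type u} (a : V) : Matrix (Fin 1) (Fin 1) V := Matrix.of fun _ _ => a

/-- The norm that a family of matrix norms gives on the first level `M_1(V) = V`. -/
def MatrixNorms.one {V : Type u} (N : MatrixNorms V) (a : V) : ℝ := N 1 (single a)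

/-- The product `α v β` of a `V`-valued matrix `v` with scalar matrices on both sides. -/
def scalarMul {V : Type u} [AddCommGroup V] [Module ℂ V] {m n : ℕ}
    (α : Matrix (Fin m) (Fin n) ℂ) (v : Matrix (Fin n) (Fin n) V)
    (β : Matrix (Fin n) (Fin m) ℂ) : Matrix (Fin m) (Fin m) V :=
  Matrix.of fun i j => ∑ k, ∑ l, (α i k * β l j) • v k l

/-- The block diagonal matrix `v ⊕ w` in `M_{m+n}(V)`. -/
def directSum {V : Type u} [AddCommGroup V] {m n : ℕ}
    (v : Matrix (Fin m) (Fin m) V) (w : Matrix (Fin n) (Fin n) V) :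
    Matrix (Fin (m + n)) (Fin (m + n)) V :=
  Matrix.reindex finSumFinEquiv finSumFinEquiv (Matrix.fromBlocks v 0 0 w)

/-- An abstract operator space: each `N n` is a norm on `M_n(V)`, and Ruan's axioms hold.
Scalar matrices carry the operator norm between Euclidean spaces. -/
structure IsOperatorSpace {V : Type u} [AddCommGroup V] [Module ℂ V] (N : MatrixNorms V) :
    Prop where
  eq_zero_iff : ∀ (n : ℕ) (v : Matrix (Fin n) (Fin n) V), N n v = 0 ↔ v = 0
  triangle : ∀ (n : ℕ) (v w : Matrix (Fin n) (Fin n) V), N n (v + w) ≤ N n v + N n w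
  homogeneous : ∀ (n : ℕ) (c : ℂ) (v : Matrix (Fin n) (Fin n) V), N n (c • v) = ‖c‖ * N n v
  scalarMul_le : ∀ (m n : ℕ) (α : Matrix (Fin m) (Fin n) ℂ) (v : Matrix (Fin n) (Fin n) V)
    (β : Matrix (Fin n) (Fin m) ℂ), N m (scalarMul α v β) ≤ ‖α‖ * N n v * ‖β‖
  directSum_eq : ∀ (m n : ℕ) (v : Matrix (Fin m) (Fin m) V) (w : Matrix (Fin n) (Fin n) V),
    N (m + n) (directSum v w) = max (N m v) (N n w)

/-- The Blecher–Ruan–Sinclair axioms of an abstract unital operator algebra: an operator space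
whose multiplication is completely contractive and whose unit has norm one
(unless the algebra is zero). -/
structure IsOperatorAlgebra {A : Type u} [Ring A] [Algebra ℂ A] (N : MatrixNorms A) : Prop
    extends IsOperatorSpace N where
  mul_le : ∀ (n : ℕ) (a b : Matrix (Fin n) (Fin n) A), N n (a * b) ≤ N n a * N n b
  one_eq : Nontrivial A → N.one 1 = 1

/-- `W`, with the matrix norms `N`, is completely isometrically isomorphic to the operator space
dual of a (complete) operator space `V`: the norm of a matrix `(φ i j)` of functionals on `V` is
the supremum of the norms of the scalar matrices `(φ i j (v k l))` over all matrices `v` of all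
sizes in the unit ball. -/
def HasOperatorSpacePredual {W : Type u} [AddCommGroup W] [Module ℂ W] (N : MatrixNorms W) :
    Prop :=
  ∃ (V : Type u) (_ : NormedAddCommGroup V) (_ : NormedSpace ℂ V) (_ : CompleteSpace V)
    (P : MatrixNorms V) (Φ : W ≃ₗ[ℂ] StrongDual ℂ V),
    IsOperatorSpace P ∧ (∀ v : V, P.one v = ‖v‖) ∧
    ∀ (n : ℕ) (f : Matrix (Fin n) (Fin n) W),
      IsLUB {r : ℝ | ∃ (m : ℕ) (v : Matrix (Fin m) (Fin m) V), P m v ≤ 1 ∧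
        r = ‖(Matrix.of fun p q : Fin n × Fin m =>
          Φ (f p.1 q.1) (v p.2 q.2) : Matrix (Fin n × Fin m) (Fin n × Fin m) ℂ)‖} (N n f)

/-- A dual operator algebra: an abstract operator algebra with an operator space predual. -/
structure IsDualOperatorAlgebra {A : Type u} [Ring A] [Algebra ℂ A] (N : MatrixNorms A) :
    Prop where
  isOperatorAlgebra : IsOperatorAlgebra N
  hasPredual : HasOperatorSpacePredual N

/-! ### Operator algebras of functions -/

variable {X : Type u}

/-- An operator algebra of functions on `X`. A `Subalgebra ℂ (X → ℂ)` always contains the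
constant functions. -/
structure IsOperatorAlgebraOfFunctions (A : Subalgebra ℂ (X → ℂ)) (N : MatrixNorms A) :
    Prop where
  separatesPoints : (A : Set (X → ℂ)).SeparatesPoints
  isOperatorAlgebra : IsOperatorAlgebra N
  bounded_eval : ∀ x : X, ∃ C : ℝ, ∀ f : A, ‖(f : X → ℂ) x‖ ≤ C * N.one f

/-- The norm of `(f i j + I_F)` in `M_n(A / I_F)`, where `I_F` is the ideal of the functions in
`A` that vanish on `F`: the infimum of `‖(f i j + g i j)‖` over all `g i j` in `I_F`. -/
def quotientNorm (A : Subalgebra ℂ (X → ℂ)) (N : MatrixNorms A) (F : Finset X) (n : ℕ)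
    (f : Matrix (Fin n) (Fin n) A) : ℝ :=
  sInf {r : ℝ | ∃ g : Matrix (Fin n) (Fin n) A,
    (∀ i j, ∀ x ∈ F, (g i j : X → ℂ) x = 0) ∧ r = N n (f + g)}

/-- Locality: the matrix norms are the suprema of the quotient norms over finite sets. -/
def IsLocal (A : Subalgebra ℂ (X → ℂ)) (N : MatrixNorms A) : Prop :=
  ∀ (n : ℕ) (f : Matrix (Fin n) (Fin n) A),
    IsLUB (Set.range fun F : Finset X => quotientNorm A N F n f) (N n f)

/-- `f` is the pointwise limit of a norm-bounded net in `A`. (Restricting the index sets of the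
nets to the universe of `X` is no loss.) -/
def IsBPWLimit (A : Subalgebra ℂ (X → ℂ)) (N : MatrixNorms A) (f : X → ℂ) : Prop :=
  ∃ (ι : Type u) (_ : Preorder ι) (_ : IsDirectedOrder ι) (_ : Nonempty ι) (s : ι → A) (C : ℝ),
    (∀ i, N.one (s i) ≤ C) ∧ ∀ x, Tendsto (fun i => (s i : X → ℂ) x) atTop (𝓝 (f x))

/-- `A` contains all its bounded pointwise limits. -/
def IsBPWComplete (A : Subalgebra ℂ (X → ℂ)) (N : MatrixNorms A) : Prop :=
  ∀ f : X → ℂ, IsBPWLimit A N f → f ∈ A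

/-! ### Operators on a Hilbert space -/

section Operators

variable {L : Type v} [NormedAddCommGroup L] [InnerProductSpace ℂ L]

/-- The operator on the Hilbert space direct sum of `n` copies of `L` with matrix `T`. -/
def matrixOperator {n : ℕ} (T : Matrix (Fin n) (Fin n) (L →L[ℂ] L)) :
    PiLp 2 (fun _ : Fin n => L) →L[ℂ] PiLp 2 (fun _ : Fin n => L) :=
  (PiLp.continuousLinearEquiv 2 ℂ (fun _ : Fin n => L)).symm.toContinuousLinearMap ∘L
    (ContinuousLinearMap.pi fun i => ∑ j, T i j ∘L ContinuousLinearMap.proj j) ∘L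
    (PiLp.continuousLinearEquiv 2 ℂ (fun _ : Fin n => L)).toContinuousLinearMap

theorem matrixOperator_apply {n : ℕ} (T : Matrix (Fin n) (Fin n) (L →L[ℂ] L))
    (g : PiLp 2 (fun _ : Fin n => L)) (i : Fin n) :
    matrixOperator T g i = ∑ j, T i j (g j) := by
  simp [matrixOperator]

/-- The weak* topology of `B(L)`, that is, the σ-weak topology: the coarsest topology for which
all functionals `T ↦ ∑ k, ⟪y k, T (x k)⟫` with square-summable sequences `x`, `y` in `L` are
continuous. -/
@[reducible]
def weakStarTopology (L : Type v) [NormedAddCommGroup L] [InnerProductSpace ℂ L] :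
    TopologicalSpace (L →L[ℂ] L) :=
  TopologicalSpace.induced
    (fun (T : L →L[ℂ] L)
      (p : {p : (ℕ → L) × (ℕ → L) //
        (Summable fun k => ‖p.1 k‖ ^ 2) ∧ Summable fun k => ‖p.2 k‖ ^ 2}) =>
      ∑' k, inner ℂ (p.1.2 k) (T (p.1.1 k)))
    inferInstance

end Operators

/-! ### The multiplier algebra of a vector-valued reproducing kernel Hilbert space -/

section Multipliers

variable {H : Type w} [NormedAddCommGroup H] [InnerProductSpace ℂ H]
variable (L : Type v) [NormedAddCommGroup L] [InnerProductSpace ℂ L] [RKHS ℂ L X H]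

/-- `f : X → ℂ` is a multiplier of `L` if `f g` belongs to `L` for every `g` in `L`. -/
def IsMultiplier (f : X → ℂ) : Prop := ∀ g : L, ∃ k : L, ∀ x, k x = f x • g x

/-- The algebra `M(K)` of all multipliers of `L`, as an algebra of functions on `X`. -/
def multiplierAlgebra : Subalgebra ℂ (X → ℂ) where
  carrier := {f | IsMultiplier L f}
  mul_mem' := by
    intro a b ha hb g
    obtain ⟨k, hk⟩ := hb g
    obtain ⟨l, hl⟩ := ha k
    exact ⟨l, fun x => by rw [hl, hk, smul_smul, Pi.mul_apply]⟩
  add_mem' := by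
    intro a b ha hb g
    obtain ⟨k, hk⟩ := ha g
    obtain ⟨l, hl⟩ := hb g
    exact ⟨k + l, fun x => by
      rw [RKHS.coe_add, Pi.add_apply, hk, hl, Pi.add_apply, add_smul]⟩
  algebraMap_mem' := by
    intro c g
    exact ⟨c • g, fun x => by simp⟩

variable {L}

/-- The element `f g` of `L`, for a multiplier `f`. -/
def multiplierFun (f : multiplierAlgebra (X := X) L) (g : L) : L :=
  (show IsMultiplier L (f : X → ℂ) from f.2) g |>.choose

theorem multiplierFun_apply (f : multiplierAlgebra (X := X) L) (g : L) (x : X) :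
    multiplierFun f g x = (f : X → ℂ) x • g x :=
  ((show IsMultiplier L (f : X → ℂ) from f.2) g).choose_spec x

/-- The linear map `g ↦ f g` on `L`, for a multiplier `f`. -/
def multiplierLinearMap (f : multiplierAlgebra (X := X) L) : L →ₗ[ℂ] L where
  toFun := multiplierFun f
  map_add' g h := RKHS.ext fun x => by simp [multiplierFun_apply]
  map_smul' c g := RKHS.ext fun x => by simp [multiplierFun_apply, smul_comm c]

theorem multiplierLinearMap_apply (f : multiplierAlgebra (X := X) L) (g : L) (x : X) :
    multiplierLinearMap f g x = (f : X → ℂ) x • g x :=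
  multiplierFun_apply f g x

variable [CompleteSpace L]

/-- The multiplication operator `M_f`, bounded by the closed graph theorem. -/
def multiplierOperator (f : multiplierAlgebra (X := X) L) : L →L[ℂ] L :=
  ContinuousLinearMap.ofSeqClosedGraph (g := multiplierLinearMap f) (by
    intro s g k hs hk
    refine RKHS.ext fun x => ?_
    have h1 : Tendsto (fun n => multiplierLinearMap f (s n) x) atTop (𝓝 (k x)) :=
      ((RKHS.continuous_eval x).tendsto k).comp hk
    have h2 : Tendsto (fun n => (f : X → ℂ) x • s n x) atTop (𝓝 ((f : X → ℂ) x • g x)) :=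
      (((RKHS.continuous_eval x).tendsto g).comp hs).const_smul _
    simp only [multiplierLinearMap_apply] at h1
    rw [multiplierLinearMap_apply]
    exact tendsto_nhds_unique h1 h2)

theorem multiplierOperator_apply (f : multiplierAlgebra (X := X) L) (g : L) (x : X) :
    multiplierOperator f g x = (f : X → ℂ) x • g x :=
  multiplierLinearMap_apply f g x

variable (L)

/-- The matrix norms of the multiplier algebra, inherited from `B(L)`: the norm of `(f i j)` is
the norm of the operator `(M_{f i j})` on the direct sum of `n` copies of `L`. -/
def multiplierNorms : MatrixNorms (multiplierAlgebra (X := X) L) :=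
  fun _ f => ‖matrixOperator (f.map multiplierOperator)‖

end Multipliers

end FunctionAlgebra

end

/-!
Write `M_f` for the multiplication operator of a multiplier `f` and `K_x η` for the adjoint of the
evaluation at `x`, applied to `η`. Everything rests on two observations about the matrix
coefficients `⟪h, T k⟫` of operators `T` on `L`.

The first is that `⟪K_x η, M_f k⟫ = f x * ⟪η, k x⟫`. As some `k₀` in `L` does not vanish at `x`, an
operator is a multiplication operator as soon as its coefficients satisfy all the equations
`⟪h, T k⟫ = ⟪h', T k'⟫` that hold for every `M_f`: the value of the multiplier at `x` is read off
from `⟪K_x (k₀ x), T k₀⟫` (`isCoefficientClosed_multiplierEmbedding`). These equations are weak*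
closed conditions, so `{M_f}` is weak* closed.

The second is that bounded families of operators have limits along ultrafilters in the weak operator
topology (`exists_weak_limit`). If bounded multipliers converge pointwise to `f`, the limit of their
operators can only be multiplication by `f` (`exists_multiplier_of_tendsto`). This is completeness
under bounded pointwise limits. It also gives locality: choose for each finite set `F` a matrix that
agrees with the given one on `F` and almost attains the quotient norm; along the finite sets these
matrices converge weakly to the given one, and the norm is weakly lower semicontinuous.

The algebraic axioms hold because `f ↦ M_f` is an injective homomorphism into `B(L)`, whose
operator matrices satisfy Ruan's axioms (`isOperatorSpace_matrixOperator`).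

The predual is the closed span `V` of the coefficients `f ↦ ⟪h, M_f k⟫` in the normed dual of the
algebra, with the operator space structure of a space of functionals (`dualNorms`). A bounded
functional `φ` on `V` yields the bounded form `(h, k) ↦ φ (⟪h, M_· k⟫)`, hence an operator `T`; the
coefficients of `T` inherit all the equations above, so `T = M_f` for some `f`, and `φ` is
evaluation at `f`. The matrix norms are recovered because the norm of an operator matrix is approximated by its
compressions to finite-dimensional subspaces (`exists_norm_compression`), and a compression is a
completely contractive matrix over `V`. This part works for any embedding into `B(L)` whose range is
determined by equations between coefficients (`hasOperatorSpacePredual_of_embedding`), and makes no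
use of trace class operators.
-/

noncomputable section

namespace FunctionAlgebra

open scoped Matrix.Norms.L2Operator

/-! ### Matrices of operators on a Hilbert space -/

theorem norm_sq_toLp_append {E : Type v} [NormedAddCommGroup E] {m n : ℕ}
    (x : PiLp 2 (fun _ : Fin m => E)) (y : PiLp 2 (fun _ : Fin n => E)) :
    ‖(WithLp.toLp 2 (Fin.append x y) : PiLp 2 (fun _ : Fin (m + n) => E))‖ ^ 2 =
      ‖x‖ ^ 2 + ‖y‖ ^ 2 := by
  simp [PiLp.norm_sq_eq_of_L2, Fin.sum_univ_add]

section MatrixOperator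

variable {E : Type v} [NormedAddCommGroup E] [InnerProductSpace ℂ E]

theorem matrixOperator_add {n : ℕ} (S T : Matrix (Fin n) (Fin n) (E →L[ℂ] E)) :
    matrixOperator (S + T) = matrixOperator S + matrixOperator T := by
  ext x i
  simp [matrixOperator_apply, Finset.sum_add_distrib]

theorem matrixOperator_smul {n : ℕ} (c : ℂ) (T : Matrix (Fin n) (Fin n) (E →L[ℂ] E)) :
    matrixOperator (c • T) = c • matrixOperator T := by
  ext x i
  simp [matrixOperator_apply, Finset.smul_sum]

theorem matrixOperator_mul {n : ℕ} (S T : Matrix (Fin n) (Fin n) (E →L[ℂ] E)) :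
    matrixOperator (S * T) = matrixOperator S ∘L matrixOperator T := by
  ext x i
  simp only [matrixOperator_apply, Matrix.mul_apply, sum_apply,
    ContinuousLinearMap.comp_apply, map_sum]
  rw [Finset.sum_comm]
  rfl

theorem matrixOperator_single_apply {n : ℕ} (T : Matrix (Fin n) (Fin n) (E →L[ℂ] E)) (i j : Fin n)
    (x : E) : matrixOperator T (PiLp.single 2 j x) i = T i j x := by
  rw [matrixOperator_apply, Finset.sum_eq_single j]
  · simp
  · intro k _ hk
    simp [hk]
  · simp

theorem matrixOperator_zero {n : ℕ} :
    matrixOperator (0 : Matrix (Fin n) (Fin n) (E →L[ℂ] E)) = 0 := by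
  ext x i
  simp [matrixOperator_apply]

theorem norm_matrixOperator_smul {n : ℕ} (c : ℂ) (T : Matrix (Fin n) (Fin n) (E →L[ℂ] E)) :
    ‖matrixOperator (c • T)‖ = ‖c‖ * ‖matrixOperator T‖ := by
  have hle : ∀ (c : ℂ) (T : Matrix (Fin n) (Fin n) (E →L[ℂ] E)),
      ‖matrixOperator (c • T)‖ ≤ ‖c‖ * ‖matrixOperator T‖ := fun c T => by
    rw [matrixOperator_smul]
    exact ContinuousLinearMap.opNorm_smul_le _ _
  refine le_antisymm (hle c T) ?_
  rcases eq_or_ne c 0 with rfl | hc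
  · rw [norm_zero, zero_mul]
    exact ContinuousLinearMap.opNorm_nonneg _
  · have h := hle c⁻¹ (c • T)
    rwa [inv_smul_smul₀ hc, norm_inv, inv_mul_eq_div, le_div_iff₀' (norm_pos_iff.2 hc)] at h

theorem norm_entry_le_norm_matrixOperator {n : ℕ} (T : Matrix (Fin n) (Fin n) (E →L[ℂ] E))
    (i j : Fin n) : ‖T i j‖ ≤ ‖matrixOperator T‖ := by
  refine ContinuousLinearMap.opNorm_le_bound _ (ContinuousLinearMap.opNorm_nonneg _) fun x => ?_
  rw [← matrixOperator_single_apply]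
  refine (PiLp.norm_apply_le _ i).trans ((ContinuousLinearMap.le_opNorm _ _).trans_eq ?_)
  rw [PiLp.norm_single]

theorem norm_matrixOperator_single (T : E →L[ℂ] E) : ‖matrixOperator (single T)‖ = ‖T‖ := by
  refine le_antisymm ?_ (norm_entry_le_norm_matrixOperator (single T) 0 0)
  refine ContinuousLinearMap.opNorm_le_bound _ (norm_nonneg _) fun x => ?_
  rw [PiLp.norm_eq_of_L2, PiLp.norm_eq_of_L2]
  simpa [matrixOperator_apply, single] using T.le_opNorm (x 0)

theorem inner_matrixOperator {n : ℕ} (T : Matrix (Fin n) (Fin n) (E →L[ℂ] E))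
    (x y : PiLp 2 (fun _ : Fin n => E)) :
    inner ℂ y (matrixOperator T x) = ∑ i, ∑ j, inner ℂ (y i) (T i j (x j)) := by
  simp [PiLp.inner_apply, matrixOperator_apply, inner_sum]

theorem norm_sum_inner_le {n : ℕ} (T : Matrix (Fin n) (Fin n) (E →L[ℂ] E))
    (x y : PiLp 2 (fun _ : Fin n => E)) :
    ‖∑ i, ∑ j, inner ℂ (y i) (T i j (x j))‖ ≤ ‖matrixOperator T‖ * ‖x‖ * ‖y‖ := by
  rw [← inner_matrixOperator]
  calc _ ≤ ‖y‖ * ‖matrixOperator T x‖ := norm_inner_le_norm _ _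
    _ ≤ ‖y‖ * (‖matrixOperator T‖ * ‖x‖) := by gcongr; exact ContinuousLinearMap.le_opNorm _ _
    _ = _ := by ring

theorem norm_le_of_norm_inner_le {F : Type*} [NormedAddCommGroup F] [InnerProductSpace ℂ F]
    {T : F →L[ℂ] F} {C : ℝ} (hC : 0 ≤ C)
    (h : ∀ x y, ‖inner ℂ y (T x)‖ ≤ C * ‖x‖ * ‖y‖) : ‖T‖ ≤ C := by
  refine T.opNorm_le_bound hC fun x => ?_
  rcases eq_or_ne (T x) 0 with h0 | h0
  · rw [h0, norm_zero]
    positivity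
  · have h1 := h x (T x)
    rw [inner_self_eq_norm_sq_to_K, norm_pow, RCLike.norm_ofReal, abs_norm, sq] at h1
    exact le_of_mul_le_mul_right h1 (norm_pos_iff.2 h0)

theorem norm_matrixOperator_le {n : ℕ} {T : Matrix (Fin n) (Fin n) (E →L[ℂ] E)} {C : ℝ}
    (hC : 0 ≤ C)
    (h : ∀ x y : PiLp 2 (fun _ : Fin n => E),
      ‖∑ i, ∑ j, inner ℂ (y i) (T i j (x j))‖ ≤ C * ‖x‖ * ‖y‖) :
    ‖matrixOperator T‖ ≤ C :=
  norm_le_of_norm_inner_le hC fun x y => by rw [inner_matrixOperator]; exact h x y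

/-- A scalar matrix `α` acts on columns of vectors of a Hilbert space with norm at most the
operator norm of `α`. Expanding the vectors in an orthonormal basis of their span reduces this
to columns of scalars. -/
theorem norm_toLp_sum_smul_le {m n : ℕ} (α : Matrix (Fin m) (Fin n) ℂ)
    (x : PiLp 2 (fun _ : Fin n => E)) :
    ‖(WithLp.toLp 2 fun i => ∑ k, α i k • x k : PiLp 2 (fun _ : Fin m => E))‖ ≤ ‖α‖ * ‖x‖ := by
  let S : Submodule ℂ E := Submodule.span ℂ (Set.range x)
  have : FiniteDimensional ℂ S := FiniteDimensional.span_of_finite ℂ (Set.finite_range x)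
  let b := stdOrthonormalBasis ℂ S
  let x' : Fin n → S := fun k => ⟨x k, Submodule.subset_span ⟨k, rfl⟩⟩
  have hnorm : ∀ s : S, ‖(s : E)‖ ^ 2 = ∑ l, ‖inner ℂ (b l) s‖ ^ 2 := fun s =>
    (b.sum_sq_norm_inner_right s).symm
  let c : Fin (Module.finrank ℂ S) → EuclideanSpace ℂ (Fin n) := fun l =>
    WithLp.toLp 2 fun k => inner ℂ (b l) (x' k)
  have hx : ‖x‖ ^ 2 = ∑ l, ‖c l‖ ^ 2 := by
    rw [PiLp.norm_sq_eq_of_L2]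
    simp_rw [EuclideanSpace.norm_sq_eq]
    rw [Finset.sum_comm]
    exact Finset.sum_congr rfl fun k _ => hnorm (x' k)
  refine le_of_sq_le_sq ?_ (by positivity)
  rw [mul_pow, hx, PiLp.norm_sq_eq_of_L2, Finset.mul_sum]
  have hα : ∀ i, ‖∑ k, α i k • x k‖ ^ 2 = ∑ l, ‖(α.mulVec (c l)) i‖ ^ 2 := by
    intro i
    have h1 : ∑ k, α i k • x k = ((∑ k, α i k • x' k : S) : E) := by simp [x']
    rw [h1, hnorm]
    refine Finset.sum_congr rfl fun l _ => ?_
    simp [Matrix.mulVec, dotProduct, c]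
  calc ∑ i, ‖∑ k, α i k • x k‖ ^ 2
      = ∑ l, ∑ i, ‖(α.mulVec (c l)) i‖ ^ 2 := by simp_rw [hα]; exact Finset.sum_comm
    _ ≤ _ := Finset.sum_le_sum fun l _ => by
      have h2 := Matrix.l2_opNorm_mulVec α (c l)
      have h3 := pow_le_pow_left₀ (norm_nonneg _) h2 2
      rw [mul_pow, EuclideanSpace.norm_sq_eq] at h3
      exact h3

theorem norm_matrixOperator_scalarMul_le {m n : ℕ} (α : Matrix (Fin m) (Fin n) ℂ)
    (T : Matrix (Fin n) (Fin n) (E →L[ℂ] E)) (β : Matrix (Fin n) (Fin m) ℂ) :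
    ‖matrixOperator (scalarMul α T β)‖ ≤ ‖α‖ * ‖matrixOperator T‖ * ‖β‖ := by
  refine ContinuousLinearMap.opNorm_le_bound _ (by positivity) fun x => ?_
  let z : PiLp 2 (fun _ : Fin n => E) := WithLp.toLp 2 fun l => ∑ j, β l j • x j
  have hz : matrixOperator (scalarMul α T β) x =
      WithLp.toLp 2 fun i => ∑ k, α i k • matrixOperator T z k := by
    ext i
    simp only [matrixOperator_apply, scalarMul, Matrix.of_apply, z, map_sum, map_smul,
      sum_apply, smul_apply, Finset.smul_sum, mul_smul]
    rw [Finset.sum_comm]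
    refine Finset.sum_congr rfl fun k _ => ?_
    rw [Finset.sum_comm]
  rw [hz]
  calc _ ≤ ‖α‖ * ‖matrixOperator T z‖ := norm_toLp_sum_smul_le α _
    _ ≤ ‖α‖ * (‖matrixOperator T‖ * (‖β‖ * ‖x‖)) := by
      gcongr
      refine (ContinuousLinearMap.le_opNorm _ _).trans ?_
      gcongr
      exact norm_toLp_sum_smul_le β x
    _ = _ := by ring

theorem matrixOperator_directSum {m n : ℕ} (S : Matrix (Fin m) (Fin m) (E →L[ℂ] E))
    (T : Matrix (Fin n) (Fin n) (E →L[ℂ] E)) (x : PiLp 2 (fun _ : Fin m => E))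
    (y : PiLp 2 (fun _ : Fin n => E)) :
    matrixOperator (directSum S T) (WithLp.toLp 2 (Fin.append x y)) =
      WithLp.toLp 2 (Fin.append (matrixOperator S x) (matrixOperator T y)) := by
  ext i
  induction i using Fin.addCases <;>
    simp [matrixOperator_apply, directSum, Fin.sum_univ_add]

theorem norm_matrixOperator_directSum {m n : ℕ} (S : Matrix (Fin m) (Fin m) (E →L[ℂ] E))
    (T : Matrix (Fin n) (Fin n) (E →L[ℂ] E)) :
    ‖matrixOperator (directSum S T)‖ = max ‖matrixOperator S‖ ‖matrixOperator T‖ := by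
  refine le_antisymm ?_ (max_le ?_ ?_)
  · refine ContinuousLinearMap.opNorm_le_bound _ (by positivity) fun z => ?_
    let x : PiLp 2 (fun _ : Fin m => E) := WithLp.toLp 2 fun i => z (Fin.castAdd n i)
    let y : PiLp 2 (fun _ : Fin n => E) := WithLp.toLp 2 fun i => z (Fin.natAdd m i)
    have hz : z = WithLp.toLp 2 (Fin.append x y) := by
      ext i
      induction i using Fin.addCases <;> simp [x, y]
    refine le_of_sq_le_sq ?_ (by positivity)
    rw [hz, matrixOperator_directSum, mul_pow, norm_sq_toLp_append, norm_sq_toLp_append, mul_add,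
      ← mul_pow, ← mul_pow]
    gcongr
    · exact (ContinuousLinearMap.le_opNorm _ x).trans (by gcongr; exact le_max_left _ _)
    · exact (ContinuousLinearMap.le_opNorm _ y).trans (by gcongr; exact le_max_right _ _)
  · refine ContinuousLinearMap.opNorm_le_bound _ (by positivity) fun x => ?_
    have h := (matrixOperator (directSum S T)).le_opNorm
      (WithLp.toLp 2 (Fin.append x (0 : PiLp 2 (fun _ : Fin n => E))))
    refine le_of_sq_le_sq ?_ (by positivity)
    have h2 := pow_le_pow_left₀ (norm_nonneg _) h 2
    rw [matrixOperator_directSum, mul_pow, norm_sq_toLp_append, norm_sq_toLp_append] at h2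
    rw [mul_pow]
    simpa using h2
  · refine ContinuousLinearMap.opNorm_le_bound _ (by positivity) fun x => ?_
    have h := (matrixOperator (directSum S T)).le_opNorm
      (WithLp.toLp 2 (Fin.append (0 : PiLp 2 (fun _ : Fin m => E)) x))
    refine le_of_sq_le_sq ?_ (by positivity)
    have h2 := pow_le_pow_left₀ (norm_nonneg _) h 2
    rw [matrixOperator_directSum, mul_pow, norm_sq_toLp_append, norm_sq_toLp_append] at h2
    rw [mul_pow]
    simpa using h2

/-- `B(E)` with the norms of its operator matrices is an operator space. -/
theorem isOperatorSpace_matrixOperator :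
    IsOperatorSpace (V := E →L[ℂ] E) fun _ T => ‖matrixOperator T‖ where
  eq_zero_iff _ T := by
    constructor
    · intro h
      ext1 i j
      exact norm_le_zero_iff.1 ((norm_entry_le_norm_matrixOperator T i j).trans_eq h)
    · rintro rfl
      rw [matrixOperator_zero]
      exact ContinuousLinearMap.opNorm_zero
  triangle _ S T := by rw [matrixOperator_add]; exact ContinuousLinearMap.opNorm_add_le _ _
  homogeneous _ c T := norm_matrixOperator_smul c T
  scalarMul_le _ _ α T β := norm_matrixOperator_scalarMul_le α T β
  directSum_eq _ _ S T := norm_matrixOperator_directSum S T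

end MatrixOperator

/-! ### Operator spaces defined by linear maps into `B(E)` -/

theorem IsOperatorSpace.nonneg {V : Type u} [AddCommGroup V] [Module ℂ V] {N : MatrixNorms V}
    (hN : IsOperatorSpace N) (n : ℕ) (v : Matrix (Fin n) (Fin n) V) : 0 ≤ N n v := by
  have h1 := hN.triangle n v ((-1 : ℂ) • v)
  rw [hN.homogeneous, neg_one_smul, add_neg_cancel, (hN.eq_zero_iff n 0).2 rfl] at h1
  simp at h1
  linarith

section Pullback

variable {V : Type u} [AddCommGroup V] [Module ℂ V] {W : Type v} [AddCommGroup W] [Module ℂ W]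

theorem map_scalarMul (θ : V →ₗ[ℂ] W) {m n : ℕ} (α : Matrix (Fin m) (Fin n) ℂ)
    (v : Matrix (Fin n) (Fin n) V) (β : Matrix (Fin n) (Fin m) ℂ) :
    (scalarMul α v β).map θ = scalarMul α (v.map θ) β := by
  ext i j
  simp [scalarMul]

theorem map_directSum (θ : V →ₗ[ℂ] W) {m n : ℕ} (v : Matrix (Fin m) (Fin m) V)
    (w : Matrix (Fin n) (Fin n) V) :
    (directSum v w).map θ = directSum (v.map θ) (w.map θ) := by
  ext i j
  induction i using Fin.addCases <;> induction j using Fin.addCases <;> simp [directSum]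

/-- The supremum of the matrix norms pulled back along a jointly injective, pointwise bounded family
of linear maps into operator spaces makes a vector space an operator space. -/
theorem isOperatorSpace_iSup {ι : Type*} [Nonempty ι] {Y : ι → Type v} [∀ i, AddCommGroup (Y i)]
    [∀ i, Module ℂ (Y i)] {N : ∀ i, MatrixNorms (Y i)} (hN : ∀ i, IsOperatorSpace (N i))
    (θ : ∀ i, V →ₗ[ℂ] Y i) (hθ : ∀ v, (∀ i, θ i v = 0) → v = 0)
    (hb : ∀ (n : ℕ) (v : Matrix (Fin n) (Fin n) V),
      BddAbove (Set.range fun i => N i n (v.map (θ i)))) :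
    IsOperatorSpace fun n (v : Matrix (Fin n) (Fin n) V) => ⨆ i, N i n (v.map (θ i)) where
  eq_zero_iff n v := by
    constructor
    · intro h
      ext k l
      refine hθ _ fun i => ?_
      have h1 : N i n (v.map (θ i)) = 0 :=
        le_antisymm ((le_ciSup (hb n v) i).trans_eq h) ((hN i).nonneg _ _)
      exact congrFun (congrFun (((hN i).eq_zero_iff _ _).1 h1) k) l
    · rintro rfl
      have h1 : ∀ i, N i n ((0 : Matrix (Fin n) (Fin n) V).map (θ i)) = 0 := fun i => by
        rw [Matrix.map_zero _ (map_zero (θ i)), (hN i).eq_zero_iff]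
      simp only [h1, ciSup_const]
  triangle n v w := by
    refine ciSup_le fun i => ?_
    rw [Matrix.map_add (θ i) (map_add (θ i))]
    exact ((hN i).triangle _ _ _).trans (add_le_add (le_ciSup (hb n v) i) (le_ciSup (hb n w) i))
  homogeneous n c v := by
    rw [Real.mul_iSup_of_nonneg (norm_nonneg c)]
    refine iSup_congr fun i => ?_
    rw [Matrix.map_smul (θ i) c (map_smul (θ i) c)]
    exact (hN i).homogeneous _ _ _
  scalarMul_le m n α v β := by
    refine ciSup_le fun i => ?_
    rw [map_scalarMul]
    refine ((hN i).scalarMul_le _ _ _ _ _).trans ?_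
    gcongr
    exact le_ciSup (hb n v) i
  directSum_eq m n v w := by
    have h1 : ∀ i, N i (m + n) ((directSum v w).map (θ i)) =
        max (N i m (v.map (θ i))) (N i n (w.map (θ i))) := fun i => by
      rw [map_directSum, (hN i).directSum_eq]
    have hb' := hb (m + n) (directSum v w)
    simp only [h1] at hb' ⊢
    refine le_antisymm (ciSup_le fun i => max_le_max (le_ciSup (hb m v) i) (le_ciSup (hb n w) i))
      (max_le (ciSup_mono hb' fun i => le_max_left _ _) (ciSup_mono hb' fun i => le_max_right _ _))

theorem isOperatorSpace_comap {N : MatrixNorms W} (hN : IsOperatorSpace N) (θ : V →ₗ[ℂ] W)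
    (hθ : Function.Injective θ) : IsOperatorSpace fun n (v : Matrix (Fin n) (Fin n) V) =>
      N n (v.map θ) := by
  have h := isOperatorSpace_iSup (ι := Unit) (fun _ => hN) (fun _ => θ)
    (fun v hv => hθ (by rw [hv (), map_zero])) (fun n v => (Set.finite_range _).bddAbove)
  simpa only [ciSup_const] using h

end Pullback

/-! ### Scalar matrices -/

theorem norm_matrixOperator_le_sum {E : Type v} [NormedAddCommGroup E] [InnerProductSpace ℂ E]
    {n : ℕ} (T : Matrix (Fin n) (Fin n) (E →L[ℂ] E)) :
    ‖matrixOperator T‖ ≤ ∑ i, ∑ j, ‖T i j‖ := by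
  refine norm_matrixOperator_le (by positivity) fun x y => ?_
  rw [Finset.sum_mul, Finset.sum_mul]
  refine norm_sum_le_of_le _ fun i _ => ?_
  rw [Finset.sum_mul, Finset.sum_mul]
  refine norm_sum_le_of_le _ fun j _ => ?_
  calc ‖inner ℂ (y i) (T i j (x j))‖ ≤ ‖y i‖ * ‖T i j (x j)‖ := norm_inner_le_norm _ _
    _ ≤ ‖y‖ * (‖T i j‖ * ‖x‖) := by
      gcongr
      · exact PiLp.norm_apply_le y i
      · exact (T i j).le_of_opNorm_le_of_le le_rfl (PiLp.norm_apply_le x j)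
    _ = _ := by ring

theorem norm_submatrix_equiv_le {ι κ : Type*} [Fintype ι] [DecidableEq ι] [Fintype κ]
    [DecidableEq κ] (e : ι ≃ κ) (a : Matrix κ κ ℂ) : ‖a.submatrix e e‖ ≤ ‖a‖ := by
  rw [Matrix.cstar_norm_def]
  refine ContinuousLinearMap.opNorm_le_bound _ (norm_nonneg _) fun x => ?_
  let x' : EuclideanSpace ℂ κ := WithLp.toLp 2 fun k => x (e.symm k)
  have hx : ‖x'‖ = ‖x‖ := by
    rw [EuclideanSpace.norm_eq, EuclideanSpace.norm_eq]
    exact congrArg _ (e.symm.sum_comp fun i => ‖x i‖ ^ 2)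
  have h := (Matrix.toEuclideanCLM (n := κ) (𝕜 := ℂ) a).le_opNorm x'
  rw [hx] at h
  refine le_trans (le_of_eq ?_) h
  rw [EuclideanSpace.norm_eq, EuclideanSpace.norm_eq, ← e.sum_comp]
  congr 1
  refine Finset.sum_congr rfl fun i _ => ?_
  simp only [Matrix.ofLp_toEuclideanCLM, Matrix.mulVec, dotProduct, Matrix.submatrix_apply, x']
  rw [← e.sum_comp]
  simp

/-- A scalar matrix whose rows and columns are indexed by pairs is an operator matrix of scalar
matrices, with the same norm. -/
theorem norm_eq_norm_matrixOperator {m n : ℕ}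
    (a : Matrix (Fin m × Fin n) (Fin m × Fin n) ℂ) :
    ‖a‖ = ‖matrixOperator (Matrix.of fun i j => Matrix.toEuclideanCLM (n := Fin n) (𝕜 := ℂ)
      (Matrix.of fun k l => a (i, k) (j, l)))‖ := by
  have key : ∀ x y : PiLp 2 (fun _ : Fin m => EuclideanSpace ℂ (Fin n)),
      inner ℂ (WithLp.toLp 2 fun p => y p.1 p.2 : EuclideanSpace ℂ (Fin m × Fin n))
        (Matrix.toEuclideanCLM (n := Fin m × Fin n) (𝕜 := ℂ) a
          (WithLp.toLp 2 fun p => x p.1 p.2)) =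
      ∑ i, ∑ j, inner ℂ (y i) (Matrix.toEuclideanCLM (n := Fin n) (𝕜 := ℂ)
      (Matrix.of fun k l => a (i, k) (j, l)) (x j)) := by
    intro x y
    simp only [PiLp.inner_apply, Matrix.ofLp_toEuclideanCLM, Matrix.mulVec, dotProduct,
      Fintype.sum_prod_type, Matrix.of_apply, RCLike.inner_apply, Finset.sum_mul]
    refine Finset.sum_congr rfl fun i _ => ?_
    rw [Finset.sum_comm]
  have hnorm : ∀ x : PiLp 2 (fun _ : Fin m => EuclideanSpace ℂ (Fin n)),
      ‖(WithLp.toLp 2 fun p => x p.1 p.2 : EuclideanSpace ℂ (Fin m × Fin n))‖ = ‖x‖ := by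
    intro x
    rw [← sq_eq_sq₀ (norm_nonneg _) (norm_nonneg _), EuclideanSpace.norm_sq_eq,
      PiLp.norm_sq_eq_of_L2, Fintype.sum_prod_type]
    exact Finset.sum_congr rfl fun i _ => (EuclideanSpace.norm_sq_eq (x i)).symm
  refine le_antisymm ?_ (norm_matrixOperator_le (norm_nonneg _) fun x y => ?_)
  · rw [Matrix.cstar_norm_def]
    refine norm_le_of_norm_inner_le (ContinuousLinearMap.opNorm_nonneg _) fun x y => ?_
    let x' : PiLp 2 (fun _ : Fin m => EuclideanSpace ℂ (Fin n)) :=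
      WithLp.toLp 2 fun i => WithLp.toLp 2 fun k => x (i, k)
    let y' : PiLp 2 (fun _ : Fin m => EuclideanSpace ℂ (Fin n)) :=
      WithLp.toLp 2 fun i => WithLp.toLp 2 fun k => y (i, k)
    have h := norm_sum_inner_le (Matrix.of fun i j => Matrix.toEuclideanCLM (n := Fin n) (𝕜 := ℂ)
      (Matrix.of fun k l => a (i, k) (j, l))) x' y'
    rw [← hnorm x', ← hnorm y'] at h
    simp only [Matrix.of_apply] at h
    rw [← key] at h
    exact h
  · simp only [Matrix.of_apply]
    rw [← key, ← hnorm x, ← hnorm y]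
    calc _ ≤ _ := norm_inner_le_norm _ _
      _ ≤ _ := mul_le_mul_of_nonneg_left (ContinuousLinearMap.le_opNorm _ _) (norm_nonneg _)
      _ = _ := by rw [← Matrix.cstar_norm_def]; ring

theorem norm_replicateCol_le {n : ℕ} (x : EuclideanSpace ℂ (Fin n)) :
    ‖(Matrix.of fun i _ => x i : Matrix (Fin n) (Fin 1) ℂ)‖ ≤ ‖x‖ := by
  rw [Matrix.l2_opNorm_def]
  refine ContinuousLinearMap.opNorm_le_bound _ (norm_nonneg _) fun z => ?_
  have hz : ‖z‖ = ‖z 0‖ := by simp [EuclideanSpace.norm_eq]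
  rw [hz, mul_comm, ← norm_smul]
  refine le_of_eq (congrArg _ ?_)
  ext i
  simp [Matrix.toEuclideanLin, Matrix.mulVec, dotProduct, mul_comm]

/-- A bounded functional on an operator space is completely bounded, with the same bound: a matrix
coefficient of `(φ (f i j))` is the value of `φ` at a product of `f` with a scalar row and a scalar
column. -/
theorem norm_map_functional_le {A : Type u} [AddCommGroup A] [Module ℂ A] {N : MatrixNorms A}
    (hN : IsOperatorSpace N) (φ : A →ₗ[ℂ] ℂ) {c : ℝ} (hc : 0 ≤ c) (hφ : ∀ a, ‖φ a‖ ≤ c * N.one a)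
    {n : ℕ} (f : Matrix (Fin n) (Fin n) A) : ‖f.map φ‖ ≤ c * N n f := by
  rw [Matrix.cstar_norm_def]
  refine norm_le_of_norm_inner_le (mul_nonneg hc (hN.nonneg _ _)) fun x y => ?_
  let col : EuclideanSpace ℂ (Fin n) → Matrix (Fin n) (Fin 1) ℂ := fun x => Matrix.of fun i _ => x i
  let g := scalarMul (col y).conjTranspose f (col x)
  have hg : inner ℂ y (Matrix.toEuclideanCLM (n := Fin n) (𝕜 := ℂ) (f.map φ) x) = φ (g 0 0) := by
    simp only [PiLp.inner_apply, Matrix.ofLp_toEuclideanCLM, Matrix.mulVec, dotProduct,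
      Matrix.map_apply, RCLike.inner_apply, Finset.sum_mul, g, scalarMul, Matrix.of_apply, map_sum,
      map_smul, col, Matrix.conjTranspose_apply, smul_eq_mul]
    refine Finset.sum_congr rfl fun i _ => Finset.sum_congr rfl fun j _ => ?_
    simp only [RCLike.star_def]
    ring
  have hg1 : single (g 0 0) = g := by
    ext i j
    rw [Subsingleton.elim i 0, Subsingleton.elim j 0]
    rfl
  rw [hg]
  refine (hφ _).trans ?_
  rw [MatrixNorms.one, hg1, mul_assoc, mul_assoc]
  refine mul_le_mul_of_nonneg_left ?_ hc
  refine (hN.scalarMul_le _ _ _ _ _).trans ?_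
  rw [Matrix.l2_opNorm_conjTranspose]
  have hx := norm_replicateCol_le x
  have hy := norm_replicateCol_le y
  calc ‖col y‖ * N n f * ‖col x‖ ≤ ‖y‖ * N n f * ‖x‖ := by
        have := hN.nonneg n f
        gcongr
    _ = _ := by ring

/-! ### Operator spaces of functionals -/

section Dual

variable {A : Type u} [NormedAddCommGroup A] [NormedSpace ℂ A]

/-- Evaluation of functionals at the entries of a matrix `f`, as a map into the bounded operators on
a Euclidean space. -/
def evalMatrix {n : ℕ} (f : Matrix (Fin n) (Fin n) A) :
    StrongDual ℂ A →ₗ[ℂ] (EuclideanSpace ℂ (Fin n) →L[ℂ] EuclideanSpace ℂ (Fin n)) where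
  toFun φ := Matrix.toEuclideanCLM (n := Fin n) (𝕜 := ℂ) (f.map φ)
  map_add' φ ψ := by
    rw [← map_add]
    rfl
  map_smul' c φ := by
    rw [RingHom.id_apply, ← map_smul]
    rfl

/-- The operator space norms of a space `V` of functionals on `A`, inherited from the operator
space dual of `A` along the embedding `J`: the supremum of the norms of `(v k l (f i j))` over all
matrices `f` in the unit balls. -/
def dualNorms (N : MatrixNorms A) {V : Type v} [NormedAddCommGroup V] [NormedSpace ℂ V]
    (J : V →ₗᵢ[ℂ] StrongDual ℂ A) : MatrixNorms V :=
  fun _ v => ⨆ f : Σ n, {f : Matrix (Fin n) (Fin n) A // N n f ≤ 1},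
    ‖matrixOperator (v.map (evalMatrix f.2.1 ∘ₗ J.toLinearMap))‖

variable {N : MatrixNorms A} {V : Type v} [NormedAddCommGroup V]
  [NormedSpace ℂ V] {J : V →ₗᵢ[ℂ] StrongDual ℂ A}

theorem nonempty_unitBalls (hN : IsOperatorSpace N) :
    Nonempty (Σ n, {f : Matrix (Fin n) (Fin n) A // N n f ≤ 1}) :=
  ⟨⟨0, 0, by rw [(hN.eq_zero_iff 0 0).2 rfl]; exact zero_le_one⟩⟩

theorem norm_map_le (hN : IsOperatorSpace N) (hN1 : ∀ a, N.one a = ‖a‖)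
    (φ : StrongDual ℂ A) {n : ℕ} (f : Matrix (Fin n) (Fin n) A) :
    ‖f.map φ‖ ≤ ‖φ‖ * N n f :=
  norm_map_functional_le hN φ.toLinearMap (norm_nonneg φ)
    (fun a => by rw [hN1]; exact φ.le_opNorm a) f

theorem bddAbove_dualNorms (hN : IsOperatorSpace N) (hN1 : ∀ a, N.one a = ‖a‖)
    {m : ℕ} (v : Matrix (Fin m) (Fin m) V) :
    BddAbove (Set.range fun f : Σ n, {f : Matrix (Fin n) (Fin n) A // N n f ≤ 1} =>
      ‖matrixOperator (v.map (evalMatrix f.2.1 ∘ₗ J.toLinearMap))‖) := by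
  refine ⟨∑ i, ∑ j, ‖v i j‖, ?_⟩
  rintro _ ⟨⟨n, f, hf⟩, rfl⟩
  refine (norm_matrixOperator_le_sum _).trans (Finset.sum_le_sum fun i _ =>
    Finset.sum_le_sum fun j _ => ?_)
  rw [← J.norm_map (v i j)]
  exact (norm_map_le hN hN1 (J (v i j)) f).trans
    (mul_le_of_le_one_right (norm_nonneg _) hf)

theorem isOperatorSpace_dualNorms (hN : IsOperatorSpace N) (hN1 : ∀ a, N.one a = ‖a‖) :
    IsOperatorSpace (dualNorms N J) := by
  have := nonempty_unitBalls hN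
  have hE : ∀ n, IsOperatorSpace (V := EuclideanSpace ℂ (Fin n) →L[ℂ] EuclideanSpace ℂ (Fin n))
      fun _ T => ‖matrixOperator T‖ := fun n => isOperatorSpace_matrixOperator
  have key := isOperatorSpace_iSup (V := V)
    (ι := Σ n, {f : Matrix (Fin n) (Fin n) A // N n f ≤ 1})
    (Y := fun f => EuclideanSpace ℂ (Fin f.1) →L[ℂ] EuclideanSpace ℂ (Fin f.1))
    (N := fun _ _ T => ‖matrixOperator T‖) (fun f => hE f.1)
    (fun f => evalMatrix f.2.1 ∘ₗ J.toLinearMap)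
  refine key (fun v hv => ?_) (fun n v => bddAbove_dualNorms hN hN1 v)
  refine (map_eq_zero_iff J J.injective).1 (ContinuousLinearMap.ext fun a => ?_)
  -- It suffices to test `v` on the scaling of `a` to the unit ball.
  let c : ℂ := ((1 + ‖a‖ : ℝ) : ℂ)⁻¹
  have hpos : 0 < 1 + ‖a‖ := by positivity
  have hc : c ≠ 0 := inv_ne_zero (by exact_mod_cast hpos.ne')
  have hca : N 1 (single (c • a)) ≤ 1 := by
    have h1 : N 1 (single (c • a)) = ‖c • a‖ := hN1 _
    rw [h1, norm_smul, norm_inv, Complex.norm_real, Real.norm_of_nonneg hpos.le,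
      inv_mul_le_one₀ hpos]
    linarith
  have h2 : Matrix.toEuclideanCLM (n := Fin 1) (𝕜 := ℂ) ((single (c • a)).map (J v)) = 0 :=
    hv ⟨1, single (c • a), hca⟩
  have h3 := congrFun (congrFun ((map_eq_zero_iff _
    (Matrix.toEuclideanCLM (n := Fin 1) (𝕜 := ℂ)).injective).1 h2) 0) 0
  have h4 : J v (c • a) = 0 := h3
  rw [map_smul, smul_eq_zero] at h4
  simpa using h4.resolve_left hc

/-- The matrix of the values of a matrix `v` of functionals at the entries of a matrix `f`. -/
def pairing (J : V →ₗᵢ[ℂ] StrongDual ℂ A) {n m : ℕ} (f : Matrix (Fin n) (Fin n) A)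
    (v : Matrix (Fin m) (Fin m) V) : Matrix (Fin n × Fin m) (Fin n × Fin m) ℂ :=
  Matrix.of fun p q => J (v p.2 q.2) (f p.1 q.1)

theorem norm_pairing {n m : ℕ} (f : Matrix (Fin n) (Fin n) A) (v : Matrix (Fin m) (Fin m) V) :
    ‖pairing J f v‖ = ‖matrixOperator (v.map (evalMatrix f ∘ₗ J.toLinearMap))‖ := by
  have h := norm_eq_norm_matrixOperator ((pairing J f v).submatrix
    (Equiv.prodComm (Fin m) (Fin n)) (Equiv.prodComm (Fin m) (Fin n)))
  refine Eq.trans (le_antisymm ?_ ?_) h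
  · have h1 := norm_submatrix_equiv_le (Equiv.prodComm (Fin n) (Fin m)) ((pairing J f v).submatrix
      (Equiv.prodComm (Fin m) (Fin n)) (Equiv.prodComm (Fin m) (Fin n)))
    exact h1
  · exact norm_submatrix_equiv_le _ _

theorem norm_pairing_le (hN : IsOperatorSpace N) (hN1 : ∀ a, N.one a = ‖a‖)
    {n m : ℕ} (f : Matrix (Fin n) (Fin n) A) (v : Matrix (Fin m) (Fin m) V) :
    ‖pairing J f v‖ ≤ dualNorms N J m v * N n f := by
  have hunit : ∀ g : Matrix (Fin n) (Fin n) A, N n g ≤ 1 → ‖pairing J g v‖ ≤ dualNorms N J m v :=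
    fun g hg => by
      rw [norm_pairing]
      exact le_ciSup (bddAbove_dualNorms hN hN1 v) ⟨n, g, hg⟩
  have hsmul : ∀ (c : ℂ) (g : Matrix (Fin n) (Fin n) A), pairing J (c • g) v = c • pairing J g v :=
    fun c g => by
      ext p q
      simp [pairing]
  rcases (hN.nonneg n f).eq_or_lt with h0 | h0
  · have hf : f = (0 : ℂ) • f := by rw [(hN.eq_zero_iff n f).1 h0.symm, smul_zero]
    rw [hf, hsmul, zero_smul, hN.homogeneous]
    simp
  · have hc : ‖(((N n f)⁻¹ : ℝ) : ℂ)‖ = (N n f)⁻¹ := by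
      rw [Complex.norm_real, Real.norm_of_nonneg (inv_nonneg.2 h0.le)]
    have h2 := hunit ((((N n f)⁻¹ : ℝ) : ℂ) • f)
      (by rw [hN.homogeneous, hc, inv_mul_cancel₀ h0.ne'])
    rw [hsmul, norm_smul, hc, inv_mul_eq_div, div_le_iff₀ h0] at h2
    exact h2

theorem dualNorms_le (hN : IsOperatorSpace N) {m : ℕ} {v : Matrix (Fin m) (Fin m) V} {C : ℝ}
    (hC : ∀ (n : ℕ) (f : Matrix (Fin n) (Fin n) A), N n f ≤ 1 → ‖pairing J f v‖ ≤ C) :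
    dualNorms N J m v ≤ C := by
  have := nonempty_unitBalls hN
  refine ciSup_le fun f => ?_
  rw [← norm_pairing]
  exact hC _ _ f.2.2

theorem dualNorms_one (hN : IsOperatorSpace N) (hN1 : ∀ a, N.one a = ‖a‖)
    (v : V) : (dualNorms N J).one v = ‖v‖ := by
  have hone : ∀ {n : ℕ} (f : Matrix (Fin n) (Fin n) A),
      ‖pairing J f (single v)‖ = ‖f.map (J v)‖ := fun f => by
    rw [norm_pairing]
    exact norm_matrixOperator_single (evalMatrix f (J v))
  rw [← J.norm_map v]
  refine le_antisymm (dualNorms_le hN fun n f hf => ?_) ?_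
  · rw [hone]
    exact (norm_map_le hN hN1 _ f).trans (mul_le_of_le_one_right (norm_nonneg _) hf)
  · have hnn : 0 ≤ (dualNorms N J).one v := (isOperatorSpace_dualNorms hN hN1).nonneg _ _
    refine (J v).opNorm_le_bound hnn fun a => ?_
    have h := norm_pairing_le (J := J) hN hN1 (single a) (single v)
    rw [hone] at h
    have h1 : N 1 (single a) = ‖a‖ := hN1 a
    rw [h1] at h
    refine le_trans ?_ h
    have h3 := (Matrix.toEuclideanCLM (n := Fin 1) (𝕜 := ℂ)
      ((single a).map (J v))).le_opNorm (EuclideanSpace.single 0 1)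
    rw [← Matrix.cstar_norm_def] at h3
    simpa [EuclideanSpace.norm_eq, single, Matrix.mulVec, dotProduct] using h3

end Dual

section Dual

variable {A : Type u} [NormedAddCommGroup A] [NormedSpace ℂ A]

/-- A complete space `V` of functionals on `A` is an operator space predual of `A` as soon as every
bounded functional on `V` is evaluation at an element of `A`, and the matrices over `V` that are
completely contractive on `A` determine the matrix norms of `A`. -/
theorem hasOperatorSpacePredual_of_norming {N : MatrixNorms A} {V : Type u}
    [NormedAddCommGroup V] [NormedSpace ℂ V] [CompleteSpace V] (J : V →ₗᵢ[ℂ] StrongDual ℂ A)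
    (hN : IsOperatorSpace N) (hN1 : ∀ a, N.one a = ‖a‖)
    (hsurj : ∀ φ : StrongDual ℂ V, ∃ a : A, ∀ v : V, φ v = J v a)
    (hnorming : ∀ (n : ℕ) (f : Matrix (Fin n) (Fin n) A) (r : ℝ), r < N n f →
      ∃ (m : ℕ) (v : Matrix (Fin m) (Fin m) V),
        (∀ (k : ℕ) (g : Matrix (Fin k) (Fin k) A), ‖pairing J g v‖ ≤ N k g) ∧
          r < ‖pairing J f v‖) :
    HasOperatorSpacePredual N := by
  let ev : A →ₗ[ℂ] StrongDual ℂ V :=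
    { toFun := fun a => NormedSpace.inclusionInDoubleDual ℂ A a ∘L J.toContinuousLinearMap
      map_add' := fun a b => by ext v; simp
      map_smul' := fun c a => by ext v; simp }
  have hev : ∀ a (v : V), ev a v = J v a := fun a v => rfl
  have hinj : Function.Injective ev := by
    rw [injective_iff_map_eq_zero]
    intro a ha
    by_contra h0
    have hpos : 0 < N 1 (single a) := by
      have h1 : N 1 (single a) = ‖a‖ := hN1 a
      rw [h1]
      exact norm_pos_iff.2 h0
    obtain ⟨m, v, -, hv⟩ := hnorming 1 (single a) 0 hpos
    have hz : pairing J (single a) v = 0 := by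
      ext p q
      change J (v p.2 q.2) a = 0
      rw [← hev, ha]
      rfl
    rw [hz, norm_zero] at hv
    exact lt_irrefl _ hv
  have hsurj' : Function.Surjective ev := fun φ => by
    obtain ⟨a, ha⟩ := hsurj φ
    exact ⟨a, ContinuousLinearMap.ext fun v => (ha v).symm⟩
  refine ⟨V, inferInstance, inferInstance, inferInstance, dualNorms N J,
    LinearEquiv.ofBijective ev ⟨hinj, hsurj'⟩, isOperatorSpace_dualNorms hN hN1,
    dualNorms_one hN hN1, fun n f => ⟨?_, fun c hc => ?_⟩⟩
  · rintro _ ⟨m, v, hv, rfl⟩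
    exact (norm_pairing_le hN hN1 f v).trans (mul_le_of_le_one_left (hN.nonneg n f) hv)
  · by_contra hlt
    obtain ⟨m, v, hv1, hv2⟩ := hnorming n f c (not_le.1 hlt)
    exact absurd (hc ⟨m, v, dualNorms_le hN fun k g hg => (hv1 k g).trans hg, rfl⟩) (not_le.2 hv2)

end Dual

/-! ### Preduals of spaces of operators -/

section Operators

variable {L : Type v} [NormedAddCommGroup L] [InnerProductSpace ℂ L]

/-- The norm of an operator matrix is approximated by the norms of its compressions to
finite-dimensional subspaces, here written as scalar matrices in an orthonormal basis: a matrix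
coefficient at two columns of vectors only involves the compression to the span of their entries. -/
theorem exists_norm_compression {n : ℕ} (T : Matrix (Fin n) (Fin n) (L →L[ℂ] L)) {r : ℝ}
    (hr : r < ‖matrixOperator T‖) :
    ∃ (m : ℕ) (e : Fin m → L), Orthonormal ℂ e ∧
      r < ‖(Matrix.of fun p q : Fin n × Fin m => inner ℂ (e p.2) (T p.1 q.1 (e q.2)) :
        Matrix (Fin n × Fin m) (Fin n × Fin m) ℂ)‖ := by
  by_contra! h
  have hr0 : 0 ≤ r := by
    simpa using (norm_nonneg _).trans (h 0 Fin.elim0 (by simp [Orthonormal]))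
  refine absurd (norm_matrixOperator_le hr0 fun x y => ?_) (not_le.2 hr)
  -- All entries of the columns `x` and `y` lie in a finite-dimensional space `S`.
  let S : Submodule ℂ L := Submodule.span ℂ (Set.range x ∪ Set.range y)
  have : FiniteDimensional ℂ S :=
    FiniteDimensional.span_of_finite ℂ ((Set.finite_range x).union (Set.finite_range y))
  let b := stdOrthonormalBasis ℂ S
  have hb : Orthonormal ℂ fun l => (b l : L) := b.orthonormal.comp_linearIsometry S.subtypeₗᵢ
  let x' : Fin n → S := fun k => ⟨x k, Submodule.subset_span (Or.inl ⟨k, rfl⟩)⟩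
  let y' : Fin n → S := fun k => ⟨y k, Submodule.subset_span (Or.inr ⟨k, rfl⟩)⟩
  let coord : (Fin n → S) → EuclideanSpace ℂ (Fin n × Fin (Module.finrank ℂ S)) := fun z =>
    WithLp.toLp 2 fun p => inner ℂ (b p.2) (z p.1)
  have hcoord : ∀ (z : Fin n → S) (z' : PiLp 2 (fun _ : Fin n => L)), (∀ i, z' i = z i) →
      ‖coord z‖ = ‖z'‖ := by
    intro z z' hz
    rw [← sq_eq_sq₀ (norm_nonneg _) (norm_nonneg _), EuclideanSpace.norm_sq_eq,
      PiLp.norm_sq_eq_of_L2, Fintype.sum_prod_type]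
    refine Finset.sum_congr rfl fun i _ => ?_
    rw [hz]
    exact b.sum_sq_norm_inner_right (z i)
  have hexp : ∀ (z : Fin n → S) i, ((z i : S) : L) = ∑ l, coord z (i, l) • (b l : L) := by
    intro z i
    conv_lhs => rw [← b.sum_repr' (z i)]
    simp [coord]
  have hle := h _ _ hb
  set a : Matrix (Fin n × Fin (Module.finrank ℂ S)) (Fin n × Fin (Module.finrank ℂ S)) ℂ :=
    Matrix.of fun p q => inner ℂ (b p.2 : L) (T p.1 q.1 (b q.2 : L)) with ha
  have hsum : ∑ i, ∑ j, inner ℂ (y i) (T i j (x j)) = inner ℂ (coord y')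
      (Matrix.toEuclideanCLM (n := Fin n × Fin (Module.finrank ℂ S)) (𝕜 := ℂ) a (coord x')) := by
    simp only [PiLp.inner_apply, Matrix.ofLp_toEuclideanCLM, Matrix.mulVec, dotProduct,
      Fintype.sum_prod_type, RCLike.inner_apply, Finset.sum_mul]
    refine Finset.sum_congr rfl fun i _ => ?_
    rw [Finset.sum_comm]
    refine Finset.sum_congr rfl fun j _ => ?_
    rw [show y i = (y' i : L) from rfl, show x j = (x' j : L) from rfl, hexp y' i, hexp x' j]
    simp only [map_sum, map_smul, sum_inner, inner_sum, inner_smul_left, inner_smul_right, ha,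
      Matrix.of_apply]
    rw [Finset.sum_comm]
    refine Finset.sum_congr rfl fun k _ => ?_
    rw [Finset.mul_sum]
    refine Finset.sum_congr rfl fun l _ => ?_
    ring
  rw [hsum, ← hcoord x' x fun _ => rfl, ← hcoord y' y fun _ => rfl]
  calc _ ≤ _ := norm_inner_le_norm _ _
    _ ≤ ‖coord y'‖ * (r * ‖coord x'‖) := by
      refine mul_le_mul_of_nonneg_left (ContinuousLinearMap.le_of_opNorm_le _ ?_ _) (norm_nonneg _)
      exact hle
    _ = _ := by ring

theorem norm_compression_le {n m : ℕ} (T : Matrix (Fin n) (Fin n) (L →L[ℂ] L)) {e : Fin m → L}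
    (he : Orthonormal ℂ e) :
    ‖(Matrix.of fun p q : Fin n × Fin m => inner ℂ (e p.2) (T p.1 q.1 (e q.2)) :
        Matrix (Fin n × Fin m) (Fin n × Fin m) ℂ)‖ ≤ ‖matrixOperator T‖ := by
  let col : EuclideanSpace ℂ (Fin n × Fin m) → PiLp 2 (fun _ : Fin n => L) := fun z =>
    WithLp.toLp 2 fun i => ∑ l, z (i, l) • e l
  have hcol : ∀ z, ‖col z‖ = ‖z‖ := by
    intro z
    rw [← sq_eq_sq₀ (norm_nonneg _) (norm_nonneg _), EuclideanSpace.norm_sq_eq,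
      PiLp.norm_sq_eq_of_L2, Fintype.sum_prod_type]
    refine Finset.sum_congr rfl fun i _ => ?_
    have h := he.inner_sum (fun l => z (i, l)) (fun l => z (i, l)) Finset.univ
    rw [inner_self_eq_norm_sq_to_K] at h
    simp only [RCLike.conj_mul] at h
    exact_mod_cast h
  rw [Matrix.cstar_norm_def]
  refine norm_le_of_norm_inner_le (ContinuousLinearMap.opNorm_nonneg _) fun x y => ?_
  refine le_trans (le_of_eq (congrArg _ ?_)) ((norm_sum_inner_le T (col x) (col y)).trans_eq
    (by rw [hcol, hcol]))
  simp only [PiLp.inner_apply, Matrix.ofLp_toEuclideanCLM, Matrix.mulVec, dotProduct,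
    Fintype.sum_prod_type, RCLike.inner_apply, Finset.sum_mul]
  refine Finset.sum_congr rfl fun i _ => ?_
  rw [Finset.sum_comm]
  refine Finset.sum_congr rfl fun j _ => ?_
  simp only [col, map_sum, map_smul, sum_inner, inner_sum, inner_smul_left, inner_smul_right,
    Matrix.of_apply]
  rw [Finset.sum_comm]
  refine Finset.sum_congr rfl fun k _ => ?_
  rw [Finset.mul_sum]
  refine Finset.sum_congr rfl fun l _ => ?_
  ring

/-- The bounded operator that represents a bounded sesquilinear form. -/
theorem exists_operator_of_bounded_form [CompleteSpace L] (b : L → L → ℂ) (C : ℝ)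
    (add_left : ∀ h h' k, b (h + h') k = b h k + b h' k)
    (smul_left : ∀ (c : ℂ) h k, b (c • h) k = starRingEnd ℂ c * b h k)
    (add_right : ∀ h k k', b h (k + k') = b h k + b h k')
    (smul_right : ∀ (c : ℂ) h k, b h (c • k) = c * b h k)
    (bound : ∀ h k, ‖b h k‖ ≤ C * ‖h‖ * ‖k‖) :
    ∃ T : L →L[ℂ] L, ∀ h k, inner ℂ h (T k) = b h k := by
  let B : L →L⋆[ℂ] L →L[ℂ] ℂ := LinearMap.mkContinuous₂
    (LinearMap.mk₂'ₛₗ (starRingEnd ℂ) (RingHom.id ℂ) b add_left smul_left add_right smul_right)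
    C bound
  refine ⟨(InnerProductSpace.continuousLinearMapOfBilin B).adjoint, fun h k => ?_⟩
  rw [ContinuousLinearMap.adjoint_inner_right, InnerProductSpace.continuousLinearMapOfBilin_apply]
  rfl

/-- The range of the embedding `M` contains every operator `T` whose matrix coefficients satisfy
all the equations `⟪h, T k⟫ = ⟪h', T k'⟫` that hold throughout that range. -/
def IsCoefficientClosed {A : Type u} [AddCommGroup A] [Module ℂ A] (M : A →ₗ[ℂ] (L →L[ℂ] L)) :
    Prop :=
  ∀ T : L →L[ℂ] L,
    (∀ h k h' k' : L, (∀ a, inner ℂ h (M a k) = inner ℂ h' (M a k')) →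
      inner ℂ h (T k) = inner ℂ h' (T k')) → ∃ a, M a = T

/-- The predual is the closed span, in the dual of `A`, of the matrix coefficients
`a ↦ ⟪h, M a k⟫`. -/
theorem hasOperatorSpacePredual_of_isometry [CompleteSpace L] {A : Type u}
    [NormedAddCommGroup A] [NormedSpace ℂ A] (M : A →ₗ[ℂ] (L →L[ℂ] L)) (hM : ∀ a, ‖M a‖ = ‖a‖)
    (hrange : IsCoefficientClosed M) :
    HasOperatorSpacePredual fun n (f : Matrix (Fin n) (Fin n) A) =>
      ‖matrixOperator (f.map M)‖ := by
  have hinj : Function.Injective M := (injective_iff_map_eq_zero M).2 fun a ha => by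
    rw [← norm_eq_zero, ← hM, ha, norm_zero]
  let coef : L → L → StrongDual ℂ A := fun h k =>
    LinearMap.mkContinuous
      { toFun := fun a => inner ℂ h (M a k)
        map_add' := fun a b => by simp
        map_smul' := fun c a => by simp } (‖h‖ * ‖k‖) fun a => by
      calc ‖inner ℂ h (M a k)‖ ≤ ‖h‖ * ‖M a k‖ := norm_inner_le_norm _ _
        _ ≤ ‖h‖ * (‖a‖ * ‖k‖) := by
          gcongr
          exact hM a ▸ (M a).le_opNorm k
        _ = _ := by ring
  have hcoef : ∀ h k a, coef h k a = inner ℂ h (M a k) := fun h k a => rfl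
  have hcoef_norm : ∀ h k, ‖coef h k‖ ≤ ‖h‖ * ‖k‖ := fun h k =>
    LinearMap.mkContinuous_norm_le _ (by positivity) _
  obtain ⟨V, hV, hmem, hmin⟩ : ∃ V : Submodule ℂ (StrongDual ℂ A),
      IsClosed (V : Set (StrongDual ℂ A)) ∧ (∀ h k, coef h k ∈ V) ∧
      ∀ S : Submodule ℂ (StrongDual ℂ A), IsClosed (S : Set (StrongDual ℂ A)) →
        (∀ h k, coef h k ∈ S) → V ≤ S :=
    ⟨(Submodule.span ℂ (Set.range fun p : L × L => coef p.1 p.2)).topologicalClosure,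
      Submodule.isClosed_topologicalClosure _,
      fun h k => Submodule.le_topologicalClosure _ (Submodule.subset_span ⟨(h, k), rfl⟩),
      fun S hS h => Submodule.topologicalClosure_minimal _
        (Submodule.span_le.2 (by rintro _ ⟨⟨x, y⟩, rfl⟩; exact h x y)) hS⟩
  have : CompleteSpace V := hV.completeSpace_coe
  refine hasOperatorSpacePredual_of_norming (V := V) V.subtypeₗᵢ
    (isOperatorSpace_comap isOperatorSpace_matrixOperator M hinj)
    (fun a => (norm_matrixOperator_single (M a)).trans (hM a)) ?_ ?_
  · intro φ
    obtain ⟨C, -, hC⟩ := SemilinearMapClass.bound_of_continuous φ φ.cont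
    let w : L → L → V := fun h k => ⟨coef h k, hmem h k⟩
    -- A functional on the predual gives a bounded form, hence an operator `T`; the relations
    -- between coefficients persist for `T`, which therefore comes from `A`.
    obtain ⟨T, hT⟩ := exists_operator_of_bounded_form (fun h k => φ (w h k)) |C|
      (fun h h' k => by
        rw [← map_add]
        congr 1
        ext a
        simp [w, hcoef])
      (fun c h k => by
        rw [← smul_eq_mul, ← map_smul]
        congr 1
        ext a
        simp [w, hcoef, mul_comm])
      (fun h k k' => by
        rw [← map_add]
        congr 1
        ext a
        simp [w, hcoef])
      (fun c h k => by
        rw [← smul_eq_mul, ← map_smul]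
        congr 1
        ext a
        simp [w, hcoef])
      (fun h k => by
        rw [mul_assoc]
        calc ‖φ (w h k)‖ ≤ C * ‖w h k‖ := hC _
          _ ≤ |C| * ‖w h k‖ := by gcongr; exact le_abs_self C
          _ ≤ |C| * (‖h‖ * ‖k‖) := by gcongr; exact hcoef_norm h k)
    obtain ⟨a, ha⟩ := hrange T fun h k h' k' hrel => by
      rw [hT, hT]
      congr 1
      ext a
      exact hrel a
    refine ⟨a, fun v => ?_⟩
    -- The kernel of the difference of the two functionals is closed and contains the coefficients.
    let ψ : V →ₗ[ℂ] ℂ := φ.toLinearMap - (ContinuousLinearMap.apply ℂ ℂ a).toLinearMap ∘ₗ V.subtype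
    have hψ : ∀ v : V, ψ v = φ v - (v : StrongDual ℂ A) a := fun v => rfl
    have hψc : Continuous ψ := AddMonoidHomClass.continuous_of_bound ψ (C + ‖a‖) fun v => by
      rw [hψ, add_mul, mul_comm ‖a‖]
      exact norm_sub_le_of_le (hC v) ((v : StrongDual ℂ A).le_opNorm a)
    let S : Submodule ℂ (StrongDual ℂ A) := (LinearMap.ker ψ).map V.subtype
    have hS : IsClosed (S : Set (StrongDual ℂ A)) :=
      hV.isClosedEmbedding_subtypeVal.isClosedMap _ (isClosed_singleton.preimage hψc)
    have hVS : V ≤ S := by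
      refine hmin S hS fun h k => ?_
      refine ⟨w h k, ?_, rfl⟩
      change ψ (w h k) = 0
      rw [hψ, ← hT, ← ha]
      exact sub_self _
    obtain ⟨v', hv', hvv⟩ := hVS v.2
    obtain rfl : v' = v := Subtype.ext hvv
    exact sub_eq_zero.1 ((hψ v').symm.trans hv')
  · intro n f r hr
    obtain ⟨m, e, he, hlt⟩ := exists_norm_compression (f.map M) hr
    refine ⟨m, Matrix.of fun k l => ⟨coef (e k) (e l), hmem _ _⟩, fun k g => ?_, hlt⟩
    exact norm_compression_le (g.map M) he

/-- A coefficient-closed linear embedding of a space `A` into `B(L)` makes `A`, with the inherited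
matrix norms, a dual operator space. -/
theorem hasOperatorSpacePredual_of_embedding [CompleteSpace L] {A : Type u} [AddCommGroup A]
    [Module ℂ A] (M : A →ₗ[ℂ] (L →L[ℂ] L)) (hM : Function.Injective M)
    (hrange : IsCoefficientClosed M) :
    HasOperatorSpacePredual fun n (f : Matrix (Fin n) (Fin n) A) =>
      ‖matrixOperator (f.map M)‖ := by
  let : NormedAddCommGroup A := NormedAddCommGroup.induced A (L →L[ℂ] L) M hM
  let : NormedSpace ℂ A := NormedSpace.induced ℂ A (L →L[ℂ] L) M
  exact hasOperatorSpacePredual_of_isometry M (fun _ => rfl) hrange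

end Operators

/-! ### The weak operator and weak* topologies -/

/-- Bounded sets of operators are relatively compact in the weak operator topology. -/
theorem exists_weak_limit {L : Type v} [NormedAddCommGroup L] [InnerProductSpace ℂ L]
    [CompleteSpace L] {ι : Type*} (U : Ultrafilter ι) (T : ι → L →L[ℂ] L) (C : ℝ)
    (hC : ∀ i, ‖T i‖ ≤ C) :
    ∃ S : L →L[ℂ] L, ∀ h k, Tendsto (fun i => inner ℂ h (T i k)) U (𝓝 (inner ℂ h (S k))) := by
  have hbound : ∀ h k i, ‖(inner ℂ h (T i k) : ℂ)‖ ≤ C * ‖h‖ * ‖k‖ := fun h k i => by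
    calc _ ≤ ‖h‖ * ‖T i k‖ := norm_inner_le_norm _ _
      _ ≤ ‖h‖ * (C * ‖k‖) := by
        gcongr
        exact (T i).le_of_opNorm_le (hC i) k
      _ = _ := by ring
  have hex : ∀ h k, ∃ z ∈ Metric.closedBall (0 : ℂ) (C * ‖h‖ * ‖k‖),
      Tendsto (fun i => (inner ℂ h (T i k) : ℂ)) U (𝓝 z) := fun h k =>
    (isCompact_closedBall (0 : ℂ) _).ultrafilter_le_nhds (U.map fun i => (inner ℂ h (T i k) : ℂ))
      (by
        rw [Ultrafilter.coe_map, le_principal_iff, mem_map]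
        exact Filter.univ_mem' fun i => mem_closedBall_zero_iff.2 (hbound h k i))
  choose b hb hlim using hex
  obtain ⟨S, hS⟩ := exists_operator_of_bounded_form b C
    (fun h h' k => tendsto_nhds_unique (hlim _ _)
      (by simpa only [inner_add_left] using (hlim h k).add (hlim h' k)))
    (fun c h k => tendsto_nhds_unique (hlim _ _)
      (by simpa only [inner_smul_left] using (hlim h k).const_mul (starRingEnd ℂ c)))
    (fun h k k' => tendsto_nhds_unique (hlim _ _)
      (by simpa only [map_add, inner_add_right] using (hlim h k).add (hlim h k')))
    (fun c h k => tendsto_nhds_unique (hlim _ _)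
      (by simpa only [map_smul, inner_smul_right] using (hlim h k).const_mul c))
    (fun h k => mem_closedBall_zero_iff.1 (hb h k))
  exact ⟨S, fun h k => by rw [hS]; exact hlim h k⟩

theorem continuous_inner_weakStarTopology {L : Type v} [NormedAddCommGroup L]
    [InnerProductSpace ℂ L] (y x : L) :
    Continuous[weakStarTopology L, inferInstance] fun T : L →L[ℂ] L => inner ℂ y (T x) := by
  let p : {p : (ℕ → L) × (ℕ → L) //
        (Summable fun k => ‖p.1 k‖ ^ 2) ∧ Summable fun k => ‖p.2 k‖ ^ 2} :=
    ⟨(Pi.single 0 x, Pi.single 0 y),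
      summable_of_ne_finset_zero (s := {0}) fun k hk => by
        simp [Pi.single_eq_of_ne (Finset.notMem_singleton.1 hk)],
      summable_of_ne_finset_zero (s := {0}) fun k hk => by
        simp [Pi.single_eq_of_ne (Finset.notMem_singleton.1 hk)]⟩
  have hp : (fun T : L →L[ℂ] L => (inner ℂ y (T x) : ℂ)) =
      (fun q => q p) ∘ fun (T : L →L[ℂ] L)
      (p : {p : (ℕ → L) × (ℕ → L) //
        (Summable fun k => ‖p.1 k‖ ^ 2) ∧ Summable fun k => ‖p.2 k‖ ^ 2}) =>
      ∑' k, inner ℂ (p.1.2 k) (T (p.1.1 k)) := by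
    ext T
    refine Eq.symm ((tsum_eq_single 0 fun k hk => ?_).trans ?_)
    · simp [p, hk]
    · simp [p]
  rw [hp]
  exact @Continuous.comp _ _ _ (weakStarTopology L) _ _ _ _ (continuous_apply p)
    continuous_induced_dom

/-! ### Multiplication operators -/

section Multipliers

variable {X : Type u} {H : Type w} [NormedAddCommGroup H] [InnerProductSpace ℂ H]
  {L : Type v} [NormedAddCommGroup L] [InnerProductSpace ℂ L] [CompleteSpace L] [RKHS ℂ L X H]

theorem multiplierOperator_eq_of_apply_eq {f : multiplierAlgebra (X := X) L} {T : L →L[ℂ] L}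
    (h : ∀ k x, T k x = (f : X → ℂ) x • k x) : multiplierOperator f = T :=
  ContinuousLinearMap.ext fun k => RKHS.ext fun x => by rw [multiplierOperator_apply, h]

variable (L) in
/-- The map `f ↦ M_f`. -/
def multiplierEmbedding : multiplierAlgebra (X := X) L →ₗ[ℂ] (L →L[ℂ] L) where
  toFun := multiplierOperator
  map_add' f g := multiplierOperator_eq_of_apply_eq fun k x => by
    simp [multiplierOperator_apply, add_smul]
  map_smul' c f := multiplierOperator_eq_of_apply_eq fun k x => by
    simp [multiplierOperator_apply, mul_smul]

theorem multiplierEmbedding_apply (f : multiplierAlgebra (X := X) L) (k : L) (x : X) :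
    multiplierEmbedding L f k x = (f : X → ℂ) x • k x :=
  multiplierOperator_apply f k x

theorem multiplierOperator_mul (f g : multiplierAlgebra (X := X) L) :
    multiplierOperator (f * g) = multiplierOperator f * multiplierOperator g :=
  multiplierOperator_eq_of_apply_eq fun k x => by
    simp [multiplierOperator_apply, mul_smul]

theorem multiplierOperator_one : multiplierOperator (1 : multiplierAlgebra (X := X) L) = 1 :=
  multiplierOperator_eq_of_apply_eq fun k x => by simp

theorem multiplierNorms_one (f : multiplierAlgebra (X := X) L) :
    (multiplierNorms L).one f = ‖multiplierOperator f‖ :=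
  norm_matrixOperator_single (multiplierOperator f)

variable [CompleteSpace H]

theorem exists_apply_ne_zero {x : X} (hx : RKHS.kernel L x x ≠ 0) : ∃ k : L, k x ≠ 0 := by
  by_contra! h
  exact hx (ContinuousLinearMap.ext fun η => by rw [← RKHS.kerFun_apply, h]; rfl)

theorem multiplierEmbedding_injective (hK : ∀ x : X, RKHS.kernel L x x ≠ 0) :
    Function.Injective (multiplierEmbedding (X := X) L) := by
  rw [injective_iff_map_eq_zero]
  intro f hf
  ext x
  obtain ⟨k, hk⟩ := exists_apply_ne_zero (hK x)
  have h := multiplierEmbedding_apply f k x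
  rw [hf, zero_apply, RKHS.coe_zero, Pi.zero_apply, eq_comm, smul_eq_zero] at h
  exact h.resolve_right hk

/-- An operator `T` on `L` acts at the point `x` as multiplication by a scalar if its matrix
coefficients `⟪K_x η, T k⟫ = ⟪η, (T k) x⟫` are the multiples of `⟪K_x (k₀ x), T k₀⟫` which they are
for multiplication operators. -/
theorem apply_eq_smul_of_inner_eq {x : X} {k₀ : L} {T : L →L[ℂ] L}
    (hT : ∀ (η : H) (k : L), inner ℂ (RKHS.kerFun L x η) (T k) =
      inner ℂ (RKHS.kerFun L x (k₀ x)) (T ((inner ℂ η (k x) / inner ℂ (k₀ x) (k₀ x)) • k₀)))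
    (k : L) : T k x = (inner ℂ (k₀ x) (T k₀ x) / inner ℂ (k₀ x) (k₀ x) : ℂ) • k x := by
  refine ext_inner_left ℂ fun η => ?_
  rw [← RKHS.kerFun_inner, hT, map_smul, inner_smul_right, inner_smul_right, RKHS.kerFun_inner]
  ring

theorem inner_multiplierEmbedding_eq {x : X} {k₀ : L} (hk₀ : k₀ x ≠ 0)
    (f : multiplierAlgebra (X := X) L) (η : H) (k : L) :
    inner ℂ (RKHS.kerFun L x η) (multiplierEmbedding L f k) =
      inner ℂ (RKHS.kerFun L x (k₀ x))
        (multiplierEmbedding L f ((inner ℂ η (k x) / inner ℂ (k₀ x) (k₀ x)) • k₀)) := by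
  have h0 : (inner ℂ (k₀ x) (k₀ x) : ℂ) ≠ 0 := inner_self_ne_zero.2 hk₀
  rw [RKHS.kerFun_inner, RKHS.kerFun_inner, multiplierEmbedding_apply, multiplierEmbedding_apply,
    RKHS.coe_smul, Pi.smul_apply]
  simp only [inner_smul_right]
  field_simp

theorem isCoefficientClosed_multiplierEmbedding (hK : ∀ x : X, RKHS.kernel L x x ≠ 0) :
    IsCoefficientClosed (multiplierEmbedding (X := X) L) := by
  intro T hT
  choose k₀ hk₀ using fun x => exists_apply_ne_zero (hK x)
  let f : X → ℂ := fun x => inner ℂ (k₀ x x) (T (k₀ x) x) / inner ℂ (k₀ x x) (k₀ x x)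
  have hf : ∀ k x, T k x = f x • k x := fun k x =>
    apply_eq_smul_of_inner_eq (fun η k => hT _ _ _ _ fun a =>
      inner_multiplierEmbedding_eq (hk₀ x) a η k) k
  exact ⟨⟨f, fun k => ⟨T k, hf k⟩⟩, multiplierOperator_eq_of_apply_eq hf⟩

theorem isOperatorAlgebra_multiplierNorms (hK : ∀ x : X, RKHS.kernel L x x ≠ 0) :
    IsOperatorAlgebra (multiplierNorms (X := X) L) where
  toIsOperatorSpace := isOperatorSpace_comap isOperatorSpace_matrixOperator
    (multiplierEmbedding L) (multiplierEmbedding_injective hK)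
  mul_le n a b := by
    have h : (a * b).map multiplierOperator =
        a.map multiplierOperator * b.map multiplierOperator := by
      ext1 i j
      simp only [Matrix.map_apply, Matrix.mul_apply, ← multiplierOperator_mul]
      exact map_sum (multiplierEmbedding L) _ _
    unfold multiplierNorms
    rw [h, matrixOperator_mul]
    exact ContinuousLinearMap.opNorm_comp_le _ _
  one_eq hA := by
    rw [multiplierNorms_one, multiplierOperator_one]
    have : Nontrivial L := by
      by_contra hL
      rw [not_nontrivial_iff_subsingleton] at hL
      exact one_ne_zero (multiplierEmbedding_injective hK
        (ContinuousLinearMap.ext fun k => Subsingleton.elim _ _) : (1 : multiplierAlgebra L) = 0)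
    exact norm_one

theorem norm_apply_le_multiplierNorms {x : X} (hx : RKHS.kernel L x x ≠ 0) :
    ∃ C : ℝ, ∀ f : multiplierAlgebra (X := X) L,
      ‖(f : X → ℂ) x‖ ≤ C * (multiplierNorms L).one f := by
  obtain ⟨k, hk⟩ := exists_apply_ne_zero hx
  have hpos := norm_pos_iff.2 hk
  refine ⟨‖k‖ * √‖RKHS.kernel L x x‖ / ‖k x‖, fun f => ?_⟩
  rw [multiplierNorms_one, div_mul_eq_mul_div, le_div_iff₀ hpos, ← norm_smul,
    ← multiplierOperator_apply]
  calc _ ≤ ‖multiplierOperator f k‖ * √‖RKHS.kernel L x x‖ := RKHS.norm_apply_le _ _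
    _ ≤ ‖multiplierOperator f‖ * ‖k‖ * √‖RKHS.kernel L x x‖ := by
      gcongr
      exact (multiplierOperator f).le_opNorm k
    _ = _ := by ring

/-! ### Bounded pointwise limits of multipliers -/

/-- A pointwise limit of a bounded family of multipliers is a multiplier, and the multiplication
operators converge in the weak operator topology. -/
theorem exists_multiplier_of_tendsto {ι : Type*} (U : Ultrafilter ι)
    (s : ι → multiplierAlgebra (X := X) L) (C : ℝ) (hC : ∀ i, ‖multiplierOperator (s i)‖ ≤ C)
    (f : X → ℂ) (hf : ∀ x, Tendsto (fun i => (s i : X → ℂ) x) U (𝓝 (f x))) :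
    ∃ g : multiplierAlgebra (X := X) L, (g : X → ℂ) = f ∧ ∀ h k : L,
      Tendsto (fun i => inner ℂ h (multiplierOperator (s i) k)) U
        (𝓝 (inner ℂ h (multiplierOperator g k))) := by
  obtain ⟨T, hT⟩ := exists_weak_limit U (fun i => multiplierOperator (s i)) C hC
  have hTf : ∀ k x, T k x = f x • k x := fun k x => by
    refine ext_inner_left ℂ fun η => ?_
    refine tendsto_nhds_unique (f := fun i => inner ℂ η ((s i : X → ℂ) x • k x)) (l := U) ?_ ?_
    · simpa only [RKHS.kerFun_inner, multiplierOperator_apply] using hT (RKHS.kerFun L x η) k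
    · simpa only [inner_smul_right] using (hf x).mul_const _
  refine ⟨⟨f, fun k => ⟨T k, hTf k⟩⟩, rfl, fun h k => ?_⟩
  rw [multiplierOperator_eq_of_apply_eq hTf]
  exact hT h k

theorem isBPWComplete_multiplierAlgebra :
    IsBPWComplete (multiplierAlgebra (X := X) L) (multiplierNorms L) := by
  rintro f ⟨ι, _, _, _, s, C, hC, hf⟩
  obtain ⟨g, rfl, -⟩ := exists_multiplier_of_tendsto (Ultrafilter.of atTop) s C
    (fun i => by rw [← multiplierNorms_one]; exact hC i) f
    (fun x => (hf x).mono_left (Ultrafilter.of_le _))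
  exact g.2

theorem isLocal_multiplierAlgebra :
    IsLocal (multiplierAlgebra (X := X) L) (multiplierNorms L) := by
  classical
  intro n f
  have hnn : ∀ g : Matrix (Fin n) (Fin n) (multiplierAlgebra (X := X) L),
      0 ≤ multiplierNorms L n g := fun g => ContinuousLinearMap.opNorm_nonneg _
  have hbdd : ∀ F : Finset X, BddBelow {r : ℝ | ∃ g : Matrix (Fin n) (Fin n) (multiplierAlgebra L),
      (∀ i j, ∀ x ∈ F, (g i j : X → ℂ) x = 0) ∧ r = multiplierNorms L n (f + g)} := fun F =>
    ⟨0, by rintro _ ⟨g, -, rfl⟩; exact hnn _⟩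
  have hmem : ∀ F : Finset X, multiplierNorms L n f ∈
      {r : ℝ | ∃ g : Matrix (Fin n) (Fin n) (multiplierAlgebra L),
      (∀ i j, ∀ x ∈ F, (g i j : X → ℂ) x = 0) ∧ r = multiplierNorms L n (f + g)} := fun F =>
    ⟨0, by simp, by rw [add_zero]⟩
  refine ⟨?_, fun c hc => le_of_forall_pos_le_add fun ε hε => ?_⟩
  · rintro _ ⟨F, rfl⟩
    exact csInf_le (hbdd F) (hmem F)
  · -- Matrices of almost minimal norm that agree with `f` on `F` converge to `f` along the finite
    -- sets `F`.
    have hex : ∀ F : Finset X, ∃ g : Matrix (Fin n) (Fin n) (multiplierAlgebra (X := X) L),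
        (∀ i j, ∀ x ∈ F, (g i j : X → ℂ) x = (f i j : X → ℂ) x) ∧
          multiplierNorms L n g ≤ c + ε := by
      intro F
      have hlt : quotientNorm (multiplierAlgebra L) (multiplierNorms L) F n f < c + ε :=
        (hc ⟨F, rfl⟩).trans_lt (by linarith)
      obtain ⟨_, ⟨g, hg, rfl⟩, hgc⟩ := exists_lt_of_csInf_lt ⟨_, hmem F⟩ hlt
      exact ⟨f + g, fun i j x hx => by simp [hg i j x hx], hgc.le⟩
    choose g hgf hgc using hex
    have hlim : ∀ i j (h k : L), Tendsto (fun F => inner ℂ h (multiplierOperator (g F i j) k))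
        (Ultrafilter.of (atTop : Filter (Finset X)))
        (𝓝 (inner ℂ h (multiplierOperator (f i j) k))) := by
      intro i j
      obtain ⟨f', hf', hlim⟩ := exists_multiplier_of_tendsto
        (Ultrafilter.of (atTop : Filter (Finset X))) (fun F => g F i j) (c + ε)
        (fun F => (norm_entry_le_norm_matrixOperator ((g F).map multiplierOperator) i j).trans
          (hgc F)) (f i j) (fun x => by
            refine (tendsto_const_nhds.congr' ?_).mono_left (Ultrafilter.of_le _)
            filter_upwards [eventually_ge_atTop {x}] with F hF
            exact (hgf F i j x (hF (Finset.mem_singleton_self x))).symm)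
      obtain rfl : f' = f i j := Subtype.ext hf'
      exact hlim
    refine norm_matrixOperator_le ((hnn _).trans (hgc ∅)) fun x y => ?_
    have hsum : Tendsto (fun F => ‖∑ i, ∑ j, inner ℂ (y i) (multiplierOperator (g F i j) (x j))‖)
        (Ultrafilter.of (atTop : Filter (Finset X)))
        (𝓝 ‖∑ i, ∑ j, inner ℂ (y i) (multiplierOperator (f i j) (x j))‖) :=
      (tendsto_finsetSum _ fun i _ => tendsto_finsetSum _ fun j _ => hlim i j _ _).norm
    refine le_of_tendsto hsum (Eventually.of_forall fun F => ?_)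
    refine (norm_sum_inner_le ((g F).map multiplierOperator) x y).trans ?_
    have := hgc F
    gcongr
    exact this

/-- The equations between matrix coefficients that characterize multiplication operators are weak*
closed conditions. -/
theorem isClosed_range_multiplierOperator (hK : ∀ x : X, RKHS.kernel L x x ≠ 0) :
    IsClosed[weakStarTopology L] (Set.range (multiplierOperator (X := X) (L := L))) := by
  let := weakStarTopology L
  have hrange : Set.range (multiplierOperator (X := X) (L := L)) =
      {T | ∀ h k h' k' : L, (∀ a, inner ℂ h (multiplierEmbedding (X := X) L a k) =
        inner ℂ h' (multiplierEmbedding (X := X) L a k')) →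
        inner ℂ h (T k) = inner ℂ h' (T k')} := by
    refine Set.Subset.antisymm ?_ fun T hT => isCoefficientClosed_multiplierEmbedding hK T hT
    rintro _ ⟨f, rfl⟩ h k h' k' hrel
    exact hrel f
  rw [hrange]
  simp only [Set.ofPred_forall]
  exact isClosed_iInter fun h => isClosed_iInter fun k => isClosed_iInter fun h' =>
    isClosed_iInter fun k' => isClosed_iInter fun _ => isClosed_eq
      (continuous_inner_weakStarTopology h k) (continuous_inner_weakStarTopology h' k')

end Multipliers

end FunctionAlgebra

end

theorem mainTheorem6 {X : Type u}
    {H : Type w} [NormedAddCommGroup H] [InnerProductSpace ℂ H] [CompleteSpace H]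
    (L : Type v) [NormedAddCommGroup L] [InnerProductSpace ℂ L] [CompleteSpace L]
    [RKHS ℂ L X H]
    (hK : ∀ x : X, RKHS.kernel L x x ≠ 0)
    (hsep : (FunctionAlgebra.multiplierAlgebra L : Set (X → ℂ)).SeparatesPoints) :
    FunctionAlgebra.IsOperatorAlgebraOfFunctions
        (FunctionAlgebra.multiplierAlgebra L) (FunctionAlgebra.multiplierNorms L) ∧
      FunctionAlgebra.IsBPWComplete
        (FunctionAlgebra.multiplierAlgebra L) (FunctionAlgebra.multiplierNorms L) ∧
      FunctionAlgebra.IsLocal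
        (FunctionAlgebra.multiplierAlgebra L) (FunctionAlgebra.multiplierNorms L) ∧
      FunctionAlgebra.IsDualOperatorAlgebra (FunctionAlgebra.multiplierNorms L) ∧
      IsClosed[FunctionAlgebra.weakStarTopology L]
        (Set.range (FunctionAlgebra.multiplierOperator (L := L))) := by
  have hA := FunctionAlgebra.isOperatorAlgebra_multiplierNorms (L := L) hK
  exact ⟨⟨hsep, hA, fun x => FunctionAlgebra.norm_apply_le_multiplierNorms (hK x)⟩,
    FunctionAlgebra.isBPWComplete_multiplierAlgebra,
    FunctionAlgebra.isLocal_multiplierAlgebra,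
    ⟨hA, FunctionAlgebra.hasOperatorSpacePredual_of_embedding
      (FunctionAlgebra.multiplierEmbedding L) (FunctionAlgebra.multiplierEmbedding_injective hK)
      (FunctionAlgebra.isCoefficientClosed_multiplierEmbedding hK)⟩,
    FunctionAlgebra.isClosed_range_multiplierOperator hK⟩
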